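/- **Setting.** Fix a database schema $\mathcal D$ (finitely many relation symbols with arities), countably many variables and an infinite set of constants. A database is a finite bag-valued instance of $\mathcal D$: each relation is a finite bag of tuples of constants; a relation is *set valued* if no tuple occurs in it more than once. A CQ query $Q(\bar X)\,{:}{-}\,\xi$ has a nonempty bag $\xi$ of relational atoms (subgoals) over variables and constants, and every variable of the head $\bar X$ occurs in $\xi$. Under bag semantics, each assignment $\gamma$ of the variables of $Q$ that maps every subgoal to a tuple stored in $D$ contributes $\prod_i m_i$ copies of $\gamma(\bar X)$ to the bag $Q(D,B)$, where $m_i$ is the multiplicity in $D$ of the tuple to which $\gamma$ maps the $i$-th subgoal. $\Sigma$ is a finite set of embedded dependencies: tgds $\phi\to\exists\bar Z\,\psi$ with $\phi,\psi$ sets of relational atoms and $\psi\neq\emptyset$; egds $\phi\to U_1=U_2$, where each $U_i$ is a constant or a variable of $\phi$; and set-enforcing egds, which say (via invisible tuple IDs) that a given relation is set valued. $\Sigma$ is *regularized*: for no tgd in $\Sigma$ can $\psi$ be partitioned into two nonempty sets of atoms all of whose common variables are universally quantified. $Q\equiv_{\Sigma,B}Q'$ means $Q(D,B)=Q'(D,B)$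 for every database $D\models\Sigma$; a chase step rewriting $Q$ into $Q'$ is *sound* under bag semantics if $Q\equiv_{\Sigma,B}Q'$. **Chase steps.** Homomorphisms fix constants. A tgd $\phi\to\exists\bar Z\,\psi$ is applicable to $Q$ with a homomorphism $h$ from $\phi$ to $\xi$ if $h$ does not extend to a homomorphism from $\phi\wedge\psi$ to $\xi$; the step adds the subgoals $\psi(h,\bar Z)$, where $\bar Z$ is renamed to distinct variables not in $Q$. An egd $\phi\to U_1=U_2$ is applicable with a homomorphism $h$ from $\phi$ to $\xi$ if $h(U_1)\ne h(U_2)$ and at least one of them is a variable; the step replaces such a variable by the other term everywhere in $Q$. Under bag semantics an egd step may in addition remove some duplicates of subgoals, always keeping at least one copy. A set-enforcing egd on $R$ applies if an $R$-subgoal occurs at least twice in $Q$; its only possible effect is such a removal of duplicates. A finite chase sequence from $Q$ to $T$ (no duplicates removed) is terminal if the canonical database of $T$ satisfies $\Sigma$; then $T=(Q)_{\Sigma,S}$ is a terminal set-chase result. **Assignment-fixing.** For a tgd $\sigma$ applicable to $Q$ with $h$, the associated test query $Q^{\sigma,h,\theta}$ has the head of $Q$ and the body $\xi\wedge\psi(h,\bar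 Z)\wedge\psi(h,\theta(\bar Z))$, where $\bar Z$ and $\theta(\bar Z)$ are disjoint lists of distinct variables not in $Q$. The tgd $\sigma$ is *assignment-fixing w.r.t. $Q$ and $h$* if $(Q^{\sigma,h,\theta})_{\Sigma,S}$ exists and, in it, each $Z_i$ has been identified with $\theta(Z_i)$ (the replacements made along the chase send both to the same term). **Theorem.** Let $\Sigma$ be a finite regularized set of embedded dependencies on $\mathcal D$, and let $Q$ be a CQ query for which $(Q)_{\Sigma,S}$ exists. Let $Q\Rightarrow^{\sigma}Q'$ be a chase step using $\sigma\in\Sigma$ and a homomorphism $h$; if $\sigma$ is a tgd, assume that $(Q^{\sigma,h,\theta})_{\Sigma,S}$ exists. Then the step is sound under bag semantics, $Q\equiv_{\Sigma,B}Q'$, if and only if one of the following holds: 1. $\sigma$ is a tgd that is assignment-fixing w.r.t. $Q$ and $h$, and for each subgoal added by the step, the relation of that subgoal is set valued on all databases satisfying $\Sigma$; or 2. $\sigma$ is an egd (possibly set-enforcing), and every subgoal of which the step removes duplicates is over a relation that is set valued on all databases satisfying $\Sigma$. -/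

import Mathlib

namespace BagChase

universe u v w

/-- A database schema: finitely many relation symbols, each with an arity. -/
structure Schema where
  Rel : Type u
  finite : Finite Rel
  arity : Rel → ℕ

/-- Terms: variables (named by natural numbers) and constants. -/
inductive Term (C : Type v) where
  | var (x : ℕ) : Term C
  | const (c : C) : Term C

/-- Atoms `r(t₁, …, tₖ)` with entries in `X`. For `X = Term C` these are relational atoms (subgoals);
for `X` a set of values they are ground atoms, that is, tuples stored in a relation. -/
structure Atom (S : Schema.{u}) (X : Type w) where
  rel : S.Rel
  args : Fin (S.arity rel) → X

variable {S : Schema.{u}} {C : Type v} {Δ : Type w}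

/-- The value of a term when constants are interpreted by `ι` and variables by `γ`. -/
def Term.eval (ι : C → Δ) (γ : ℕ → Δ) : Term C → Δ
  | .var x => γ x
  | .const c => ι c

def Atom.eval (ι : C → Δ) (γ : ℕ → Δ) (a : Atom S (Term C)) : Atom S Δ :=
  ⟨a.rel, fun i => (a.args i).eval ι γ⟩

/-- Substitution of terms for variables; constants are fixed. -/
def Term.subst (h : ℕ → Term C) (t : Term C) : Term C := t.eval Term.const h

def Atom.subst (h : ℕ → Term C) (a : Atom S (Term C)) : Atom S (Term C) := a.eval Term.const h

/-- The variables occurring in a set of atoms. -/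
def atomVars (A : Set (Atom S (Term C))) : Set ℕ :=
  {x | ∃ a ∈ A, ∃ i, a.args i = Term.var x}

/-- Multiplicity of an element in a bag. -/
noncomputable def mult {α : Type w} (s : Multiset α) (a : α) : ℕ :=
  open Classical in s.count a

/-! ### Databases -/

/-- A bag-valued database instance with values in `Δ`: a finite bag of stored tuples. The (finite)
bag of tuples with symbol `r` is the relation for `r`. -/
abbrev Database (S : Schema.{u}) (Δ : Type w) := Multiset (Atom S Δ)

/-- The relation for `r` is set valued in `D`: no tuple of it is stored more than once. -/
def Database.SetValued (D : Database S Δ) (r : S.Rel) : Prop :=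
  ∀ a : Atom S Δ, a.rel = r → mult D a ≤ 1

/-! ### Conjunctive queries -/

/-- A safe conjunctive query `Q(head) :- body`; the body is a nonempty bag of subgoals. -/
@[ext] structure CQ (S : Schema.{u}) (C : Type v) where
  head : List (Term C)
  body : Multiset (Atom S (Term C))
  body_ne : body ≠ 0
  safe : ∀ x, Term.var x ∈ head → x ∈ atomVars {a | a ∈ body}

/-- The variables of a query. -/
def CQ.vars (Q : CQ S C) : Set ℕ := atomVars {a | a ∈ Q.body}

/-- The query with additional subgoals. -/
def CQ.addAtoms (Q : CQ S C) (A : Multiset (Atom S (Term C))) : CQ S C where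
  head := Q.head
  body := Q.body + A
  body_ne := fun h => Q.body_ne (by simpa using (add_eq_zero.mp h).1)
  safe := fun x hx => by
    obtain ⟨a, ha, i, hi⟩ := Q.safe x hx
    exact ⟨a, Multiset.mem_add.mpr (Or.inl ha), i, hi⟩

/-- Application of a substitution to head and body, subgoal by subgoal (duplicates are kept). -/
def CQ.subst (Q : CQ S C) (ρ : ℕ → Term C) : CQ S C where
  head := Q.head.map (Term.subst ρ)
  body := Q.body.map (Atom.subst ρ)
  body_ne := fun h => Q.body_ne (by simpa using h)
  safe := fun x hx => by
    obtain ⟨t, ht, htx⟩ := List.mem_map.mp hx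
    cases t with
    | const c => simp [Term.subst, Term.eval] at htx
    | var y =>
      obtain ⟨a, ha, i, hi⟩ := Q.safe y ht
      refine ⟨a.subst ρ, Multiset.mem_map_of_mem _ ha, i, ?_⟩
      change ((a.args i).eval Term.const ρ) = Term.var x
      rw [hi]
      exact htx

/-- The canonical database of a query, as a symbolic set-valued database: its values are the
constants of the query and its variables, the latter read as further pairwise distinct values. -/
noncomputable def CQ.canonicalDB (Q : CQ S C) : Database S (Term C) :=
  open Classical in Q.body.dedup

/-! ### Evaluation under bag semantics -/

/-- The assignments for the body of `Q` that satisfy it w.r.t. `D`. An assignment of the variables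
of `Q` is represented by its extension to all variable names that takes one fixed value on the names
not occurring in `Q`, so that each assignment is represented exactly once. -/
def CQ.satAssignments [Nonempty C] (Q : CQ S C) (D : Database S C) : Set (ℕ → C) :=
  {γ | (∀ x, x ∉ Q.vars → γ x = Classical.arbitrary C) ∧ ∀ a ∈ Q.body, a.eval id γ ∈ D}

theorem atomVars_finite (s : Multiset (Atom S (Term C))) : (atomVars {a | a ∈ s}).Finite := by
  classical
  have h : (⋃ a ∈ s.toFinset, ⋃ i : Fin (S.arity a.rel),
      {x : ℕ | a.args i = Term.var x}).Finite := by
    refine Set.Finite.biUnion s.toFinset.finite_toSet fun a _ => Set.finite_iUnion fun i => ?_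
    refine Set.Subsingleton.finite fun x hx y hy => ?_
    have := (show a.args i = Term.var x from hx).symm.trans hy
    exact Term.var.inj this
  refine h.subset ?_
  rintro x ⟨a, ha, i, hi⟩
  simp only [Set.mem_iUnion]
  exact ⟨a, Multiset.mem_toFinset.mpr ha, i, hi⟩

theorem CQ.satAssignments_finite [Nonempty C] (Q : CQ S C) (D : Database S C) :
    (Q.satAssignments D).Finite := by
  classical
  have hA : {c : C | ∃ b ∈ D, ∃ i, b.args i = c}.Finite := by
    have h : (⋃ b ∈ D.toFinset, Set.range b.args).Finite :=
      Set.Finite.biUnion D.toFinset.finite_toSet fun b _ => Set.finite_range _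
    refine h.subset ?_
    rintro c ⟨b, hb, i, hi⟩
    simp only [Set.mem_iUnion]
    exact ⟨b, Multiset.mem_toFinset.mpr hb, i, hi⟩
  have : Finite Q.vars := atomVars_finite Q.body
  have : Finite {c : C | ∃ b ∈ D, ∃ i, b.args i = c} := hA
  let f : Q.satAssignments D → (Q.vars → {c : C | ∃ b ∈ D, ∃ i, b.args i = c}) := fun γ x =>
    ⟨γ.1 x.1, by
      obtain ⟨a, ha, i, hi⟩ := x.2
      refine ⟨_, γ.2.2 a ha, i, ?_⟩
      change (a.args i).eval id γ.1 = _
      rw [hi]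
      rfl⟩
  have hf : Function.Injective f := by
    intro γ δ h
    apply Subtype.ext
    funext x
    by_cases hx : x ∈ Q.vars
    · exact congrArg Subtype.val (congrFun h ⟨x, hx⟩)
    · rw [γ.2.1 x hx, δ.2.1 x hx]
  exact Finite.of_injective f hf

/-- The answer to `Q` on `D` under bag semantics: every satisfying assignment `γ` contributes
`m₁ ⋯ mₙ` copies of the tuple `γ(head)`, where `mᵢ` is the multiplicity in `D` of the tuple to which
`γ` maps the `i`-th subgoal. -/
noncomputable def CQ.bagAnswer [Nonempty C] (Q : CQ S C) (D : Database S C) :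
    Multiset (List C) :=
  ∑ γ ∈ (Q.satAssignments_finite D).toFinset,
    Multiset.replicate (Q.body.map fun a => mult D (a.eval id γ)).prod
      (Q.head.map (Term.eval id γ))

/-! ### Embedded dependencies -/

/-- A tuple-generating dependency `body → ∃ Z̄, head`; both sides are sets of relational atoms. -/
structure Tgd (S : Schema.{u}) (C : Type v) where
  body : Finset (Atom S (Term C))
  head : Finset (Atom S (Term C))
  head_ne : head.Nonempty

/-- The existentially quantified variables `Z̄` of a tgd. -/
def Tgd.exVars (τ : Tgd S C) : Set ℕ := atomVars {a | a ∈ τ.head} \ atomVars {a | a ∈ τ.body}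

/-- A tgd is regularized if its right-hand side has no nonshared partition, i.e. no partition into
two nonempty sets of atoms all of whose common variables are universally quantified. -/
def Tgd.Regularized (τ : Tgd S C) : Prop :=
  ¬ ∃ A B : Set (Atom S (Term C)), A.Nonempty ∧ B.Nonempty ∧ Disjoint A B ∧
    A ∪ B = {a | a ∈ τ.head} ∧ atomVars A ∩ atomVars B ⊆ atomVars {a | a ∈ τ.body}

/-- An equality-generating dependency `body → lhs = rhs`. -/
structure Egd (S : Schema.{u}) (C : Type v) where
  body : Finset (Atom S (Term C))
  lhs : Term C
  rhs : Term C
  lhs_safe : ∀ x, lhs = Term.var x → x ∈ atomVars {a | a ∈ body}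
  rhs_safe : ∀ x, rhs = Term.var x → x ∈ atomVars {a | a ∈ body}

/-- Dependencies. `setEnforcing r` is the set-enforcing egd on `r`: the functional dependency saying
that two stored tuples of `r` which agree everywhere except on their (invisible) tuple IDs also have
the same tuple ID. -/
inductive Dependency (S : Schema.{u}) (C : Type v) where
  | tgd (τ : Tgd S C) : Dependency S C
  | egd (e : Egd S C) : Dependency S C
  | setEnforcing (r : S.Rel) : Dependency S C

/-- `D` satisfies a dependency, constants being interpreted by `ι`. -/
def Dependency.Holds (ι : C → Δ) (D : Database S Δ) : Dependency S C → Prop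
  | .tgd τ => ∀ γ : ℕ → Δ, (∀ a ∈ τ.body, a.eval ι γ ∈ D) →
      ∃ γ' : ℕ → Δ, (∀ x ∈ atomVars {a | a ∈ τ.body}, γ' x = γ x) ∧
        ∀ a ∈ τ.head, a.eval ι γ' ∈ D
  | .egd e => ∀ γ : ℕ → Δ, (∀ a ∈ e.body, a.eval ι γ ∈ D) → e.lhs.eval ι γ = e.rhs.eval ι γ
  | .setEnforcing r => D.SetValued r

/-- `D ⊨ Sig`. -/
def Models (ι : C → Δ) (D : Database S Δ) (Sig : Finset (Dependency S C)) : Prop :=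
  ∀ σ ∈ Sig, σ.Holds ι D

/-- A finite regularized set of dependencies. -/
def RegularizedSet (Sig : Finset (Dependency S C)) : Prop :=
  ∀ τ : Tgd S C, Dependency.tgd τ ∈ Sig → τ.Regularized

/-- The relation for `r` is set valued on all databases satisfying `Sig`. -/
def SetValuedOn (Sig : Finset (Dependency S C)) (r : S.Rel) : Prop :=
  ∀ D : Database S C, Models id D Sig → D.SetValued r

/-- Bag equivalence of two queries under `Sig`. -/
def BagEquiv [Nonempty C] (Sig : Finset (Dependency S C)) (Q Q' : CQ S C) : Prop :=
  ∀ D : Database S C, Models id D Sig → Q.bagAnswer D = Q'.bagAnswer D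

/-! ### The chase -/

/-- `h` maps every atom of `A` to a subgoal in `ξ`. -/
def IsHom (h : ℕ → Term C) (A : Set (Atom S (Term C))) (ξ : Multiset (Atom S (Term C))) : Prop :=
  ∀ a ∈ A, a.subst h ∈ ξ

/-- The chase of `Q` with the tgd `τ` is applicable using `h`. -/
def Tgd.Applicable (τ : Tgd S C) (Q : CQ S C) (h : ℕ → Term C) : Prop :=
  IsHom h {a | a ∈ τ.body} Q.body ∧
    ¬ ∃ h' : ℕ → Term C, (∀ x ∈ atomVars {a | a ∈ τ.body}, h' x = h x) ∧
      IsHom h' {a | a ∈ τ.body} Q.body ∧ IsHom h' {a | a ∈ τ.head} Q.body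

/-- `z` names the existential variables of `τ` by distinct variables that do not occur in `Q`. -/
def Tgd.FreshNames (τ : Tgd S C) (Q : CQ S C) (z : ℕ → ℕ) : Prop :=
  Set.InjOn z τ.exVars ∧ ∀ x ∈ τ.exVars, z x ∉ Q.vars

/-- The atoms `head(h(X̄), z(Z̄))`. -/
noncomputable def Tgd.headInstance (τ : Tgd S C) (h : ℕ → Term C) (z : ℕ → ℕ) :
    Multiset (Atom S (Term C)) :=
  open Classical in
  τ.head.val.map (Atom.subst fun x => if x ∈ τ.exVars then Term.var (z x) else h x)

/-- The substitution that replaces the variable `x` by the term `t`. -/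
def replaceVar (x : ℕ) (t : Term C) : ℕ → Term C := Function.update Term.var x t

/-- `ChaseStep σ h Q ρ Q'`: a chase step with `σ` and the homomorphism `h` rewrites `Q` into `Q'`;
`ρ` records what becomes of the variables of `Q`. (A set-enforcing egd never changes the set of
subgoals, and every canonical database satisfies it.) -/
inductive ChaseStep :
    Dependency S C → (ℕ → Term C) → CQ S C → (ℕ → Term C) → CQ S C → Prop
  | tgd (τ : Tgd S C) (h : ℕ → Term C) (z : ℕ → ℕ) (Q : CQ S C)
      (happ : τ.Applicable Q h) (hz : τ.FreshNames Q z) :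
      ChaseStep (.tgd τ) h Q Term.var (Q.addAtoms (τ.headInstance h z))
  | egd (e : Egd S C) (h : ℕ → Term C) (x : ℕ) (t : Term C) (Q : CQ S C)
      (hhom : IsHom h {a | a ∈ e.body} Q.body)
      (heq : (e.lhs.subst h = Term.var x ∧ e.rhs.subst h = t) ∨
        (e.rhs.subst h = Term.var x ∧ e.lhs.subst h = t))
      (hne : Term.var x ≠ t) :
      ChaseStep (.egd e) h Q (replaceVar x t) (Q.subst (replaceVar x t))

/-- `Chase Sig Q ρ Q'`: a finite `Sig`-chase sequence leads from `Q` to `Q'`; `ρ` is the composition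
of the replacements made along the sequence. -/
inductive Chase (Sig : Finset (Dependency S C)) (Q : CQ S C) : (ℕ → Term C) → CQ S C → Prop
  | refl : Chase Sig Q Term.var Q
  | step {ρ ρ' h : ℕ → Term C} {Q₁ Q₂ : CQ S C} {σ : Dependency S C}
      (hc : Chase Sig Q ρ Q₁) (hσ : σ ∈ Sig) (hs : ChaseStep σ h Q₁ ρ' Q₂) :
      Chase Sig Q (fun x => (ρ x).subst ρ') Q₂

/-- `T` is a terminal result of the chase of `Q` under set semantics, with replacements `ρ`. -/
def SetChaseResult (Sig : Finset (Dependency S C)) (Q : CQ S C) (ρ : ℕ → Term C) (T : CQ S C) :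
    Prop :=
  Chase Sig Q ρ T ∧ Models Term.const T.canonicalDB Sig

/-- A terminal result of the chase of `Q` under set semantics exists. -/
def HasSetChaseResult (Sig : Finset (Dependency S C)) (Q : CQ S C) : Prop :=
  ∃ ρ T, SetChaseResult Sig Q ρ T

/-! ### Assignment-fixing tgds -/

/-- The associated test query for `Q`, `τ` and `h`: two copies of the right-hand side of `τ` are
added to `Q`, the existential variables being named by `z` in one copy and by `z'` (which is `θ`
applied to `z`) in the other. -/
noncomputable def testQuery (Q : CQ S C) (τ : Tgd S C) (h : ℕ → Term C) (z z' : ℕ → ℕ) : CQ S C :=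
  Q.addAtoms (τ.headInstance h z + τ.headInstance h z')

/-- Admissible names for the two copies: fresh, and disjoint from each other. -/
def TestNames (Q : CQ S C) (τ : Tgd S C) (z z' : ℕ → ℕ) : Prop :=
  τ.FreshNames Q z ∧ τ.FreshNames Q z' ∧ ∀ x ∈ τ.exVars, ∀ y ∈ τ.exVars, z x ≠ z' y

/-- The terminal set-chase result of the associated test query exists. -/
def TestChaseExists (Sig : Finset (Dependency S C)) (Q : CQ S C) (τ : Tgd S C)
    (h : ℕ → Term C) : Prop :=
  ∃ z z', TestNames Q τ z z' ∧ HasSetChaseResult Sig (testQuery Q τ h z z')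

/-- `τ` is assignment fixing w.r.t. `Q` and `h`: the terminal set-chase result of the associated
test query exists, and the chase identifies each existential variable with its copy. -/
def AssignmentFixing (Sig : Finset (Dependency S C)) (Q : CQ S C) (τ : Tgd S C)
    (h : ℕ → Term C) : Prop :=
  ∃ z z', TestNames Q τ z z' ∧ HasSetChaseResult Sig (testQuery Q τ h z z') ∧
    ∀ ρ T, SetChaseResult Sig (testQuery Q τ h z z') ρ T → ∀ x ∈ τ.exVars, ρ (z x) = ρ (z' x)

/-! ### Chase steps under bag semantics -/

/-- `Q'` results from `Q` by removing some (possibly no) duplicates of subgoals. -/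
def RemovesDuplicates (Q Q' : CQ S C) : Prop :=
  Q'.head = Q.head ∧ Q'.body ≤ Q.body ∧ ∀ a ∈ Q.body, a ∈ Q'.body

/-- `BagChaseStep σ h Q Q₁ Q'`: a chase step with `σ` and `h` that rewrites `Q` into `Q'`. Here `Q₁`
is the query before duplicates are removed: an egd step may be followed by the removal of
duplicates of subgoals, a tgd step only adds subgoals. A set-enforcing egd on `r` applies when two
copies of an `r`-subgoal (with distinct invisible tuple IDs) are present; it equates their IDs,
which changes nothing else. -/
inductive BagChaseStep :
    Dependency S C → (ℕ → Term C) → CQ S C → CQ S C → CQ S C → Prop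
  | tgd {τ : Tgd S C} {h ρ : ℕ → Term C} {Q Q' : CQ S C}
      (hs : ChaseStep (.tgd τ) h Q ρ Q') : BagChaseStep (.tgd τ) h Q Q' Q'
  | egd {e : Egd S C} {h ρ : ℕ → Term C} {Q Q₁ Q' : CQ S C}
      (hs : ChaseStep (.egd e) h Q ρ Q₁) (hd : RemovesDuplicates Q₁ Q') :
      BagChaseStep (.egd e) h Q Q₁ Q'
  | setEnforcing {h : ℕ → Term C} {Q Q' : CQ S C} (a : Atom S (Term C))
      (ha : 2 ≤ mult Q.body a) (hd : RemovesDuplicates Q Q') :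
      BagChaseStep (.setEnforcing a.rel) h Q Q Q'

/-- Egds, including the set-enforcing ones. -/
def Dependency.IsEgd : Dependency S C → Prop
  | .tgd _ => False
  | .egd _ => True
  | .setEnforcing _ => True

end BagChase

open BagChase

/-!
Everything is reduced to a statement about a single database. If the body of `Q'` is the body of `Q`
with a bag `A` of further subgoals, and every satisfying assignment of `Q` in `D` extends to one of
`Q'`, then restriction is a surjection from the assignments of `Q'` onto those of `Q` which does not
decrease weights. Hence the two answers agree on `D` exactly when restriction is injective and all
subgoals in `A` are mapped to tuples of multiplicity one (`bagAnswer_eq_iff_of_body_eq_add`).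

A tgd step and the removal of duplicates are both of this form, while the substitution made by an egd
induces a bijection of satisfying assignments on every model (`bagAnswer_subst`). It remains to
compare the criterion "on all models" with the chase.

* Satisfying assignments are transported along chase sequences (`Chase.exists_satisfies`). Two
  extensions of an assignment along a tgd step form an assignment for the test query, so they agree
  as soon as the chase identifies the two copies of the existential variables.
* Conversely, the canonical database of a terminal chase result becomes a model over the constants
  after its variables are replaced by fresh constants, and on it the only coincidences among
  variables are those forced by the chase (`SetChaseResult.exists_model`). For the test query this
  model carries two extensions that differ unless the tgd is assignment fixing. Doubling the tuples
  of a relation on which set-valuedness is not enforced keeps it a model (`Models.double`) and makes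
  multiplicity one fail.
-/

namespace BagChase

universe u v w

variable {S : Schema.{u}} {C : Type v} {Δ : Type w}

/-! ### Evaluation of terms and atoms -/

theorem Term.eval_subst (ι : C → Δ) (γ : ℕ → Δ) (ρ : ℕ → Term C) (t : Term C) :
    (t.subst ρ).eval ι γ = t.eval ι fun x => (ρ x).eval ι γ := by
  cases t <;> rfl

theorem Term.subst_var (t : Term C) : t.subst Term.var = t := by
  cases t <;> rfl

theorem Term.eval_congr {ι : C → Δ} {γ γ' : ℕ → Δ} {t : Term C}
    (h : ∀ x, t = Term.var x → γ x = γ' x) : t.eval ι γ = t.eval ι γ' := by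
  cases t with
  | var x => exact h x rfl
  | const c => rfl

theorem Atom.eval_subst (ι : C → Δ) (γ : ℕ → Δ) (ρ : ℕ → Term C) (a : Atom S (Term C)) :
    (a.subst ρ).eval ι γ = a.eval ι fun x => (ρ x).eval ι γ := by
  unfold Atom.subst Atom.eval
  congr 1
  funext i
  exact Term.eval_subst ι γ ρ _

theorem Atom.subst_subst (ρ ρ' : ℕ → Term C) (a : Atom S (Term C)) :
    (a.subst ρ).subst ρ' = a.subst fun x => (ρ x).subst ρ' :=
  Atom.eval_subst _ _ _ _

theorem Atom.subst_var (a : Atom S (Term C)) : a.subst Term.var = a := by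
  cases a
  unfold Atom.subst Atom.eval
  congr 1
  funext i
  exact Term.subst_var _

theorem Atom.eval_congr {ι : C → Δ} {γ γ' : ℕ → Δ} {a : Atom S (Term C)}
    (h : ∀ x i, a.args i = Term.var x → γ x = γ' x) : a.eval ι γ = a.eval ι γ' := by
  unfold Atom.eval
  congr 1
  funext i
  exact Term.eval_congr fun x hx => h x i hx

/-- Entrywise application of a map to an atom. -/
def Atom.map {X Y : Type*} (f : X → Y) (a : Atom S X) : Atom S Y := ⟨a.rel, fun i => f (a.args i)⟩

theorem Atom.map_eval {Δ' : Type*} {ι : C → Δ} {γ : ℕ → Δ} {ι' : C → Δ'} {f : Δ → Δ'}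
    {a : Atom S (Term C)} (h : ∀ c i, a.args i = Term.const c → f (ι c) = ι' c) :
    (a.eval ι γ).map f = a.eval ι' (f ∘ γ) := by
  unfold Atom.map Atom.eval
  congr 1
  funext i
  change f ((a.args i).eval ι γ) = _
  cases hi : a.args i with
  | var x => rfl
  | const c => exact h c i hi

/-! ### Satisfying assignments -/

/-- `γ` maps every atom of the bag `A` to a tuple stored in `D`. -/
def Satisfies (γ : ℕ → C) (A : Multiset (Atom S (Term C))) (D : Database S C) : Prop :=
  ∀ a ∈ A, a.eval id γ ∈ D

theorem Satisfies.congr {γ γ' : ℕ → C} {Q : CQ S C} {D : Database S C}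
    (hγ : Satisfies γ Q.body D) (h : Set.EqOn γ' γ Q.vars) : Satisfies γ' Q.body D := by
  intro a ha
  rw [Atom.eval_congr (γ' := γ) fun x i hx => h ⟨a, ha, i, hx⟩]
  exact hγ a ha

theorem Satisfies.subst {γ : ℕ → C} {ρ : ℕ → Term C} {Q : CQ S C} {D : Database S C}
    (hγ : Satisfies γ Q.body D) (h : ∀ x ∈ Q.vars, (ρ x).eval id γ = γ x) :
    Satisfies γ (Q.subst ρ).body D := by
  intro b hb
  obtain ⟨a, ha, rfl⟩ := Multiset.mem_map.mp hb
  rw [Atom.eval_subst, Atom.eval_congr (γ' := γ) fun x i hx => h x ⟨a, ha, i, hx⟩]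
  exact hγ a ha

/-- The normal form of an assignment of the variables of `Q`: outside the variables of `Q` it takes
the value required by `CQ.satAssignments`. -/
noncomputable def CQ.restrict [Nonempty C] (Q : CQ S C) (γ : ℕ → C) : ℕ → C :=
  open Classical in fun x => if x ∈ Q.vars then γ x else Classical.arbitrary C

theorem CQ.restrict_eqOn [Nonempty C] (Q : CQ S C) (γ : ℕ → C) :
    Set.EqOn (Q.restrict γ) γ Q.vars := fun _ hx => if_pos hx

theorem CQ.restrict_eq_iff [Nonempty C] {Q : CQ S C} {γ γ' : ℕ → C} :
    Q.restrict γ = Q.restrict γ' ↔ Set.EqOn γ γ' Q.vars := by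
  constructor
  · intro h x hx
    rw [← Q.restrict_eqOn γ hx, h, Q.restrict_eqOn γ' hx]
  · intro h
    funext x
    by_cases hx : x ∈ Q.vars
    · rw [Q.restrict_eqOn γ hx, Q.restrict_eqOn γ' hx, h hx]
    · simp [CQ.restrict, hx]

theorem CQ.mem_satAssignments [Nonempty C] {Q : CQ S C} {D : Database S C} {γ : ℕ → C} :
    γ ∈ Q.satAssignments D ↔ Q.restrict γ = γ ∧ Satisfies γ Q.body D := by
  refine and_congr_left fun _ => ⟨fun h => ?_, fun h x hx => ?_⟩
  · funext x
    by_cases hx : x ∈ Q.vars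
    · exact if_pos hx
    · exact (if_neg hx).trans (h x hx).symm
  · rw [← h]
    exact if_neg hx

theorem CQ.restrict_mem [Nonempty C] {Q : CQ S C} {D : Database S C} {γ : ℕ → C}
    (hγ : Satisfies γ Q.body D) : Q.restrict γ ∈ Q.satAssignments D :=
  CQ.mem_satAssignments.mpr
    ⟨CQ.restrict_eq_iff.mpr (Q.restrict_eqOn γ), hγ.congr (Q.restrict_eqOn γ)⟩

theorem CQ.map_head_congr {Q : CQ S C} {γ γ' : ℕ → C} (h : Set.EqOn γ γ' Q.vars) :
    Q.head.map (Term.eval id γ) = Q.head.map (Term.eval id γ') := by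
  refine List.map_congr_left fun t ht => Term.eval_congr fun x hx => h ?_
  subst hx
  exact Q.safe x ht

/-- The number of copies of `γ(head)` that the assignment `γ` contributes to the answer. -/
noncomputable def CQ.weight (Q : CQ S C) (D : Database S C) (γ : ℕ → C) : ℕ :=
  (Q.body.map fun a => mult D (a.eval id γ)).prod

theorem CQ.weight_congr {Q : CQ S C} {D : Database S C} {γ γ' : ℕ → C}
    (h : Set.EqOn γ γ' Q.vars) : Q.weight D γ = Q.weight D γ' := by
  unfold CQ.weight
  congr 1
  refine Multiset.map_congr rfl fun a ha => ?_
  rw [Atom.eval_congr fun x i hx => h ⟨a, ha, i, hx⟩]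

theorem mult_pos {α : Type*} {s : Multiset α} {a : α} (h : a ∈ s) : 0 < mult s a := by
  classical
  exact Multiset.count_pos.mpr h

theorem CQ.weight_pos {Q : CQ S C} {D : Database S C} {γ : ℕ → C}
    (h : Satisfies γ Q.body D) : 0 < Q.weight D γ := by
  refine Nat.pos_of_ne_zero fun h0 => ?_
  obtain ⟨a, ha, ha0⟩ := Multiset.mem_map.mp (Multiset.prod_eq_zero_iff.mp h0)
  exact (mult_pos (h a ha)).ne' ha0

/-! ### Comparison of bag answers on one database -/

/-- A surjection that does not decrease positive weights and preserves the total weight is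
injective and preserves each weight. -/
theorem eq_and_injOn_of_sum_eq {α β : Type*} {s : Finset α} {t : Finset β} {φ : β → α}
    {f : α → ℕ} {g : β → ℕ} (hφ : ∀ b ∈ t, φ b ∈ s) (hsurj : ∀ a ∈ s, ∃ b ∈ t, φ b = a)
    (hle : ∀ b ∈ t, f (φ b) ≤ g b) (hpos : ∀ b ∈ t, 0 < g b)
    (hsum : ∑ a ∈ s, f a = ∑ b ∈ t, g b) :
    (∀ b ∈ t, g b = f (φ b)) ∧ Set.InjOn φ t := by
  classical
  have hfib : ∀ a ∈ s, f a ≤ ∑ b ∈ t with φ b = a, g b := by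
    intro a ha
    obtain ⟨b, hb, rfl⟩ := hsurj a ha
    exact (hle b hb).trans
      (Finset.single_le_sum (f := g) (fun _ _ => Nat.zero_le _) (Finset.mem_filter.mpr ⟨hb, rfl⟩))
  rw [← Finset.sum_fiberwise_of_maps_to hφ g] at hsum
  have heq := (Finset.sum_eq_sum_iff_of_le hfib).mp hsum
  refine ⟨fun b hb => le_antisymm ?_ (hle b hb), fun b hb b' hb' hbb' => ?_⟩
  · rw [heq _ (hφ b hb)]
    exact Finset.single_le_sum (f := g) (fun _ _ => Nat.zero_le _)
      (Finset.mem_filter.mpr ⟨hb, rfl⟩)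
  · by_contra hne
    have hsub : ({b, b'} : Finset β) ⊆ t.filter fun c => φ c = φ b := by
      intro c hc
      rcases Finset.mem_insert.mp hc with rfl | hc
      · exact Finset.mem_filter.mpr ⟨hb, rfl⟩
      · rw [Finset.mem_singleton.mp hc]
        exact Finset.mem_filter.mpr ⟨hb', hbb'.symm⟩
    have h1 := Finset.sum_le_sum_of_subset (f := g) hsub
    rw [Finset.sum_pair hne, ← heq _ (hφ b hb)] at h1
    have h2 := hle b hb
    have h3 := hpos b' hb'
    omega

theorem CQ.card_bagAnswer [Nonempty C] (Q : CQ S C) (D : Database S C) :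
    (Q.bagAnswer D).card = ∑ γ ∈ (Q.satAssignments_finite D).toFinset, Q.weight D γ := by
  simp [CQ.bagAnswer, CQ.weight]

theorem vars_subset_of_body_eq_add {Q Q' : CQ S C} {A : Multiset (Atom S (Term C))}
    (hbody : Q'.body = Q.body + A) : Q.vars ⊆ Q'.vars := by
  rintro x ⟨a, ha, i, hi⟩
  exact ⟨a, by simpa [hbody] using Or.inl ha, i, hi⟩

/-- Adding the subgoals `A` leaves the answer on `D` unchanged iff every satisfying assignment has
only one extension to the new variables and this extension maps `A` to tuples that are stored once;
`hext` says that there is at least one extension. -/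
theorem bagAnswer_eq_iff_of_body_eq_add [Nonempty C] {Q Q' : CQ S C} {D : Database S C}
    {A : Multiset (Atom S (Term C))} (hhead : Q'.head = Q.head) (hbody : Q'.body = Q.body + A)
    (hext : ∀ γ, Satisfies γ Q.body D → ∃ γ', Satisfies γ' Q'.body D ∧ Set.EqOn γ' γ Q.vars) :
    Q.bagAnswer D = Q'.bagAnswer D ↔
      ∀ γ, Satisfies γ Q'.body D → (∀ a ∈ A, mult D (a.eval id γ) = 1) ∧
        ∀ γ', Satisfies γ' Q'.body D → Set.EqOn γ γ' Q.vars → Set.EqOn γ γ' Q'.vars := by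
  have hsub : ∀ {γ}, Satisfies γ Q'.body D → Satisfies γ Q.body D := fun hγ a ha =>
    hγ a (by simpa [hbody] using Or.inl ha)
  have hvars := vars_subset_of_body_eq_add hbody
  have hw : ∀ γ, Q'.weight D γ = Q.weight D γ * (A.map fun a => mult D (a.eval id γ)).prod := by
    intro γ
    simp [CQ.weight, hbody]
  have hmem : ∀ γ ∈ (Q'.satAssignments_finite D).toFinset,
      Q.restrict γ ∈ (Q.satAssignments_finite D).toFinset := by
    intro γ hγ
    rw [Set.Finite.mem_toFinset] at hγ ⊢
    exact CQ.restrict_mem (hsub (CQ.mem_satAssignments.mp hγ).2)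
  have hsurj : ∀ γ ∈ (Q.satAssignments_finite D).toFinset,
      ∃ γ' ∈ (Q'.satAssignments_finite D).toFinset, Q.restrict γ' = γ := by
    intro γ hγ
    rw [Set.Finite.mem_toFinset, CQ.mem_satAssignments] at hγ
    obtain ⟨γ', hγ', hγγ'⟩ := hext γ hγ.2
    refine ⟨Q'.restrict γ', (Set.Finite.mem_toFinset _).mpr (CQ.restrict_mem hγ'), ?_⟩
    rw [← hγ.1]
    exact CQ.restrict_eq_iff.mpr fun x hx => (Q'.restrict_eqOn γ' (hvars hx)).trans (hγγ' hx)
  constructor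
  · intro hans
    have hsum := congrArg Multiset.card hans
    rw [CQ.card_bagAnswer, CQ.card_bagAnswer] at hsum
    obtain ⟨h1, h2⟩ := eq_and_injOn_of_sum_eq hmem hsurj (fun γ hγ => by
        rw [Set.Finite.mem_toFinset, CQ.mem_satAssignments] at hγ
        rw [CQ.weight_congr (Q.restrict_eqOn γ), hw]
        refine Nat.le_mul_of_pos_right _ (Nat.pos_of_mul_pos_left (a := Q.weight D γ) ?_)
        rw [← hw]
        exact CQ.weight_pos hγ.2)
      (fun γ hγ => by
        rw [Set.Finite.mem_toFinset, CQ.mem_satAssignments] at hγ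
        exact CQ.weight_pos hγ.2) hsum
    intro γ hγ
    have hγm : Q'.restrict γ ∈ (Q'.satAssignments_finite D).toFinset :=
      (Set.Finite.mem_toFinset _).mpr (CQ.restrict_mem hγ)
    refine ⟨fun a ha => ?_, fun γ' hγ' hQ => ?_⟩
    · have h := h1 _ hγm
      rw [CQ.weight_congr (Q'.restrict_eqOn γ), CQ.weight_congr (Q.restrict_eqOn _),
        CQ.weight_congr ((Q'.restrict_eqOn γ).mono hvars), hw] at h
      have h' := Nat.eq_of_mul_eq_mul_left (CQ.weight_pos (hsub hγ)) (h.trans (mul_one _).symm)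
      exact Nat.dvd_one.mp (h' ▸ Multiset.dvd_prod (Multiset.mem_map_of_mem _ ha))
    · refine CQ.restrict_eq_iff.mp (h2 hγm
        ((Set.Finite.mem_toFinset _).mpr (CQ.restrict_mem hγ')) ?_)
      refine CQ.restrict_eq_iff.mpr fun x hx => ?_
      rw [Q'.restrict_eqOn γ (hvars hx), Q'.restrict_eqOn γ' (hvars hx), hQ hx]
  · intro h
    symm
    refine Finset.sum_bij (fun γ _ => Q.restrict γ) hmem ?_ (fun γ hγ => ?_) ?_
    · intro γ hγ γ' hγ' hr
      rw [Set.Finite.mem_toFinset, CQ.mem_satAssignments] at hγ hγ'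
      rw [← hγ.1, ← hγ'.1]
      exact CQ.restrict_eq_iff.mpr ((h γ hγ.2).2 γ' hγ'.2 (CQ.restrict_eq_iff.mp hr))
    · obtain ⟨γ', h1, h2⟩ := hsurj γ hγ
      exact ⟨γ', h1, h2⟩
    · intro γ hγ
      rw [Set.Finite.mem_toFinset, CQ.mem_satAssignments] at hγ
      change Multiset.replicate (Q'.weight D γ) _ = Multiset.replicate (Q.weight D _) _
      rw [hhead, CQ.map_head_congr (Q.restrict_eqOn γ), CQ.weight_congr (Q.restrict_eqOn γ), hw,
        Multiset.map_congr rfl (h γ hγ.2).1]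
      simp

/-- A substitution that every satisfying assignment respects does not change the answer. -/
theorem bagAnswer_subst [Nonempty C] {Q : CQ S C} {D : Database S C} {ρ : ℕ → Term C}
    (h : ∀ γ, Satisfies γ Q.body D → ∀ x ∈ Q.vars, (ρ x).eval id γ = γ x) :
    (Q.subst ρ).bagAnswer D = Q.bagAnswer D := by
  have hvars : ∀ {x y}, x ∈ Q.vars → ρ x = Term.var y → y ∈ (Q.subst ρ).vars := by
    rintro x y ⟨a, ha, i, hi⟩ hxy
    refine ⟨a.subst ρ, Multiset.mem_map_of_mem _ ha, i, ?_⟩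
    change (a.args i).eval Term.const ρ = _
    rw [hi]
    exact hxy
  have hsat : ∀ {γ}, Satisfies γ (Q.subst ρ).body D →
      Satisfies (fun x => (ρ x).eval id γ) Q.body D := by
    intro γ hγ a ha
    rw [← Atom.eval_subst]
    exact hγ _ (Multiset.mem_map_of_mem _ ha)
  refine Finset.sum_bij (fun γ _ => Q.restrict fun x => (ρ x).eval id γ) ?_ ?_ ?_ ?_
  · intro γ hγ
    rw [Set.Finite.mem_toFinset] at hγ ⊢
    exact CQ.restrict_mem (hsat (CQ.mem_satAssignments.mp hγ).2)
  · intro γ hγ γ' hγ' hr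
    rw [Set.Finite.mem_toFinset, CQ.mem_satAssignments] at hγ hγ'
    rw [CQ.restrict_eq_iff] at hr
    rw [← hγ.1, ← hγ'.1]
    refine CQ.restrict_eq_iff.mpr ?_
    rintro y ⟨b, hb, i, hi⟩
    obtain ⟨a, ha, rfl⟩ := Multiset.mem_map.mp hb
    change (a.args i).eval Term.const ρ = _ at hi
    cases hx : a.args i with
    | const c => simp [hx, Term.eval] at hi
    | var x =>
      rw [hx] at hi
      have := hr ⟨a, ha, i, hx⟩
      change ρ x = _ at hi
      simpa [hi, Term.eval] using this
  · intro γ hγ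
    rw [Set.Finite.mem_toFinset, CQ.mem_satAssignments] at hγ
    refine ⟨(Q.subst ρ).restrict γ, (Set.Finite.mem_toFinset _).mpr
      (CQ.restrict_mem (hγ.2.subst (h γ hγ.2))), ?_⟩
    rw [← hγ.1]
    refine CQ.restrict_eq_iff.mpr fun x hx => ?_
    simp only [hγ.1]
    rw [Term.eval_congr fun y hy => (Q.subst ρ).restrict_eqOn γ (hvars hx hy)]
    exact h γ hγ.2 x hx
  · intro γ hγ
    rw [CQ.map_head_congr (Q.restrict_eqOn _)]
    change Multiset.replicate _ ((Q.head.map (Term.subst ρ)).map _) =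
      Multiset.replicate (Q.weight D _) _
    rw [CQ.weight_congr (Q.restrict_eqOn _)]
    congr 1
    · simp [CQ.weight, CQ.subst, Atom.eval_subst]
    · simp [Term.eval_subst]

/-! ### Satisfying assignments along the chase -/

theorem IsHom.satisfies {h : ℕ → Term C} {A : Set (Atom S (Term C))}
    {ξ : Multiset (Atom S (Term C))} (hh : IsHom h A ξ) {γ : ℕ → C} {D : Database S C}
    (hγ : Satisfies γ ξ D) : ∀ a ∈ A, a.eval id (fun x => (h x).eval id γ) ∈ D := by
  intro a ha
  rw [← Atom.eval_subst]
  exact hγ _ (hh a ha)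

theorem IsHom.mem_vars {h : ℕ → Term C} {A : Set (Atom S (Term C))} {Q : CQ S C}
    (hh : IsHom h A Q.body) {x y : ℕ} (hx : x ∈ atomVars A) (hy : h x = Term.var y) :
    y ∈ Q.vars := by
  obtain ⟨a, ha, i, hi⟩ := hx
  refine ⟨_, hh a ha, i, ?_⟩
  change (a.args i).eval Term.const h = _
  rw [hi]
  exact hy

/-- An assignment can be given prescribed values at freshly named variables. -/
theorem exists_override {Q : CQ S C} {τ : Tgd S C} {z : ℕ → ℕ} (hz : τ.FreshNames Q z)
    (γ δ : ℕ → C) : ∃ γ' : ℕ → C, (∀ x ∈ τ.exVars, γ' (z x) = δ x) ∧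
      ∀ y, (∀ x ∈ τ.exVars, z x ≠ y) → γ' y = γ y := by
  classical
  refine ⟨fun y => if h : ∃ x ∈ τ.exVars, z x = y then δ h.choose else γ y, fun x hx => ?_,
    fun y hy => dif_neg fun ⟨x, hx, hxy⟩ => hy x hx hxy⟩
  have h : ∃ x' ∈ τ.exVars, z x' = z x := ⟨x, hx, rfl⟩
  simp only [dif_pos h]
  rw [hz.1 h.choose_spec.1 hx h.choose_spec.2]

/-- If `γ'` gives the existential variables of `τ`, named by `z`, the values prescribed by `δ`, and
agrees with `γ` on `Q`, then it maps `head(h(X̄), z(Z̄))` to the image of the head of `τ` under the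
assignment that is `δ` on `Z̄` and `γ ∘ h` on `X̄`. -/
theorem eval_headInstance {Q : CQ S C} {τ : Tgd S C} {h : ℕ → Term C} {z : ℕ → ℕ}
    (hh : IsHom h {a | a ∈ τ.body} Q.body) {γ γ' δ : ℕ → C} (hγ : Set.EqOn γ' γ Q.vars)
    (hδ : ∀ x ∈ τ.exVars, γ' (z x) = δ x)
    (hb : ∀ x ∈ atomVars {a | a ∈ τ.body}, δ x = (h x).eval id γ) {D : Database S C} :
    Satisfies γ' (τ.headInstance h z) D ↔ ∀ a ∈ τ.head, a.eval id δ ∈ D := by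
  classical
  unfold Satisfies Tgd.headInstance
  rw [Multiset.forall_mem_map_iff]
  refine forall₂_congr fun a ha => ?_
  rw [Atom.eval_subst, Atom.eval_congr (γ' := δ)]
  intro x i hx
  by_cases hex : x ∈ τ.exVars
  · simpa [hex, Term.eval] using hδ x hex
  · have hxb : x ∈ atomVars {a | a ∈ τ.body} := by
      by_contra hxb
      exact hex ⟨⟨a, ha, i, hx⟩, hxb⟩
    simp only [hex, if_false]
    rw [hb x hxb]
    exact Term.eval_congr fun y hy => hγ (hh.mem_vars hxb hy)

theorem Satisfies.add {γ : ℕ → C} {A B : Multiset (Atom S (Term C))} {D : Database S C}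
    (hA : Satisfies γ A D) (hB : Satisfies γ B D) : Satisfies γ (A + B) D := fun a ha =>
  (Multiset.mem_add.mp ha).elim (hA a) (hB a)

/-- On a model of `τ`, satisfying assignments of `Q` extend to the result of a step with `τ`. -/
theorem Tgd.exists_extension {Q : CQ S C} {τ : Tgd S C} {h : ℕ → Term C} {z : ℕ → ℕ}
    (hh : IsHom h {a | a ∈ τ.body} Q.body) (hz : τ.FreshNames Q z) {D : Database S C}
    (hD : (Dependency.tgd τ).Holds id D) {γ : ℕ → C} (hγ : Satisfies γ Q.body D) :
    ∃ γ', Satisfies γ' (Q.addAtoms (τ.headInstance h z)).body D ∧ Set.EqOn γ' γ Q.vars := by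
  obtain ⟨δ, hδ, hδD⟩ := hD _ (hh.satisfies hγ)
  obtain ⟨γ', h1, h2⟩ := exists_override hz γ δ
  have heq : Set.EqOn γ' γ Q.vars := fun y hy => h2 y fun x hx hxy => hz.2 x hx (hxy ▸ hy)
  exact ⟨γ', (hγ.congr heq).add ((eval_headInstance hh heq h1 hδ).mpr hδD), heq⟩

theorem Egd.replaceVar_eval {e : Egd S C} {h : ℕ → Term C} {x : ℕ} {t : Term C} {Q : CQ S C}
    (hh : IsHom h {a | a ∈ e.body} Q.body)
    (heq : (e.lhs.subst h = Term.var x ∧ e.rhs.subst h = t) ∨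
      (e.rhs.subst h = Term.var x ∧ e.lhs.subst h = t)) {D : Database S C}
    (hD : (Dependency.egd e).Holds id D) {γ : ℕ → C} (hγ : Satisfies γ Q.body D) (y : ℕ) :
    (replaceVar x t y).eval id γ = γ y := by
  have he := hD _ (hh.satisfies hγ)
  rw [← Term.eval_subst, ← Term.eval_subst] at he
  by_cases hy : y = x
  · subst hy
    have hr : replaceVar y t y = t := Function.update_self ..
    rw [hr]
    rcases heq with ⟨h1, h2⟩ | ⟨h1, h2⟩ <;> rw [h1, h2] at he
    · exact he.symm
    · exact he
  · simp [replaceVar, hy, Term.eval]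

theorem Chase.subst_mem {Sig : Finset (Dependency S C)} {Q T : CQ S C} {ρ : ℕ → Term C}
    (hc : Chase Sig Q ρ T) : ∀ a ∈ Q.body, a.subst ρ ∈ T.body := by
  induction hc with
  | refl => exact fun a ha => by rwa [Atom.subst_var]
  | step _ _ hs ih =>
    intro a ha
    rw [← Atom.subst_subst]
    cases hs with
    | tgd τ h z Q happ hz =>
      rw [Atom.subst_var]
      exact Multiset.mem_add.mpr (Or.inl (ih a ha))
    | egd e h x t Q hhom heq hne => exact Multiset.mem_map_of_mem _ (ih a ha)

theorem Chase.exists_args_eq {Sig : Finset (Dependency S C)} {Q T : CQ S C} {ρ : ℕ → Term C}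
    (hc : Chase Sig Q ρ T) {x : ℕ} (hx : x ∈ Q.vars) : ∃ a ∈ T.body, ∃ i, a.args i = ρ x := by
  obtain ⟨a, ha, i, hi⟩ := hx
  refine ⟨_, hc.subst_mem a ha, i, ?_⟩
  change (a.args i).eval Term.const ρ = _
  rw [hi]
  rfl

/-- On a model, every satisfying assignment of `Q` comes from one of the chase result. -/
theorem Chase.exists_satisfies {Sig : Finset (Dependency S C)} {Q T : CQ S C} {ρ : ℕ → Term C}
    (hc : Chase Sig Q ρ T) {D : Database S C} (hD : Models id D Sig) {γ : ℕ → C}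
    (hγ : Satisfies γ Q.body D) :
    ∃ γ', Satisfies γ' T.body D ∧ ∀ x ∈ Q.vars, (ρ x).eval id γ' = γ x := by
  induction hc with
  | refl => exact ⟨γ, hγ, fun x _ => rfl⟩
  | @step ρ' ρ'' h Q₁ Q₂ σ hc hσ hs ih =>
    obtain ⟨γ', h1, h2⟩ := ih
    have hD' := hD _ hσ
    cases hs with
    | tgd τ h z Q happ hz =>
      obtain ⟨γ'', h3, h4⟩ := τ.exists_extension happ.1 hz hD' h1
      refine ⟨γ'', h3, fun x hx => ?_⟩
      rw [← h2 x hx]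
      change ((ρ' x).subst Term.var).eval id γ'' = _
      rw [Term.subst_var]
      obtain ⟨a, ha, i, hi⟩ := hc.exists_args_eq hx
      exact Term.eval_congr fun y hy => h4 ⟨a, ha, i, hi.trans hy⟩
    | egd e h x t Q hhom heq hne =>
      have hr := Egd.replaceVar_eval hhom heq hD' h1
      refine ⟨γ', h1.subst fun y _ => hr y, fun y hy => ?_⟩
      rw [Term.eval_subst, ← h2 y hy]
      exact Term.eval_congr fun w _ => hr w

/-! ### Models from terminal chase results -/

/-- The constants occurring in a set of atoms. -/
def atomConsts (A : Set (Atom S (Term C))) : Set C := {c | ∃ a ∈ A, ∃ i, a.args i = Term.const c}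

theorem atomConsts_finite {A : Set (Atom S (Term C))} (hA : A.Finite) : (atomConsts A).Finite := by
  have h : (⋃ a ∈ A, ⋃ i : Fin (S.arity a.rel), {c : C | a.args i = Term.const c}).Finite := by
    refine hA.biUnion fun a _ => Set.finite_iUnion fun i => ?_
    exact Set.Subsingleton.finite fun c hc d hd =>
      Term.const.inj ((show a.args i = Term.const c from hc).symm.trans hd)
  refine h.subset ?_
  rintro c ⟨a, ha, i, hi⟩
  simp only [Set.mem_iUnion]
  exact ⟨a, ha, i, hi⟩

/-- The left-hand side of a dependency; it is empty for set-enforcing egds. -/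
def Dependency.premise : Dependency S C → Finset (Atom S (Term C))
  | .tgd τ => τ.body
  | .egd e => e.body
  | .setEnforcing _ => ∅

/-- Variables can be read as distinct constants outside a given finite set `K`; `g` undoes this. -/
theorem exists_freeze [Infinite C] {K : Set C} (hK : K.Finite) :
    ∃ (f : Term C → C) (g : C → Term C), (∀ c, f (Term.const c) = c) ∧ (∀ c, f (g c) = c) ∧
      (∀ x, g (f (Term.var x)) = Term.var x) ∧ ∀ c ∈ K, g c = Term.const c := by
  classical
  have := hK.infinite_compl.to_subtype
  let e : ℕ ↪ (Kᶜ : Set C) := Infinite.natEmbedding _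
  refine ⟨Term.eval id fun x => (e x : C),
    fun c => if h : ∃ x, (e x : C) = c then Term.var h.choose else Term.const c,
    fun c => rfl, fun c => ?_, fun x => ?_, fun c hc => ?_⟩
  · by_cases h : ∃ x, (e x : C) = c
    · simpa [h, Term.eval] using h.choose_spec
    · simp [h, Term.eval]
  · have h : ∃ y, (e y : C) = e x := ⟨x, rfl⟩
    change (if h : ∃ y, (e y : C) = e x then Term.var h.choose else _) = _
    rw [dif_pos h]
    exact congrArg Term.var (e.injective (Subtype.ext h.choose_spec))
  · refine dif_neg ?_
    rintro ⟨x, hx⟩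
    exact (e x).2 (hx ▸ hc)

theorem Atom.map_map_eq_self {X Y : Type*} {f : X → Y} {g : Y → X} {a : Atom S X}
    (h : ∀ i, g (f (a.args i)) = a.args i) : (a.map f).map g = a := by
  cases a
  unfold Atom.map
  congr 1
  funext i
  exact h i

/-- A terminal chase result yields a model over the constants, together with a satisfying assignment
of `Q` that identifies only those variables which the chase identifies. -/
theorem SetChaseResult.exists_model [Infinite C] {Sig : Finset (Dependency S C)} {Q T : CQ S C}
    {ρ : ℕ → Term C} (hT : SetChaseResult Sig Q ρ T) :
    ∃ D : Database S C, Models id D Sig ∧ ∃ γ, Satisfies γ Q.body D ∧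
      ∀ x ∈ Q.vars, ∀ y ∈ Q.vars, γ x = γ y → ρ x = ρ y := by
  classical
  obtain ⟨hc, hM⟩ := hT
  have hK : (atomConsts {a | a ∈ T.body} ∪
      ⋃ σ ∈ Sig, atomConsts {a | a ∈ σ.premise}).Finite :=
    (atomConsts_finite (Multiset.finite_toSet _)).union
      (Set.Finite.biUnion (Finset.finite_toSet _) fun σ _ =>
        atomConsts_finite (Finset.finite_toSet _))
  obtain ⟨f, g, hf, hfg, hgf, hg⟩ := exists_freeze hK
  have hgT : ∀ a ∈ T.body, ∀ i, g (f (a.args i)) = a.args i := by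
    intro a ha i
    cases hi : a.args i with
    | var x => exact hgf x
    | const c => rw [hf, hg c (Or.inl ⟨a, ha, i, hi⟩)]
  have hmem : ∀ {a}, a ∈ T.canonicalDB ↔ a ∈ T.body := Multiset.mem_dedup
  have hback : ∀ b ∈ T.canonicalDB.map (Atom.map f), b.map g ∈ T.canonicalDB := by
    intro b hb
    obtain ⟨a, ha, rfl⟩ := Multiset.mem_map.mp hb
    rwa [Atom.map_map_eq_self (hgT a (hmem.mp ha))]
  -- Pulling back along `g` turns a match of a premise in the frozen database into one in `T`.
  have hpull : ∀ σ ∈ Sig, ∀ γ : ℕ → C,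
      (∀ a ∈ σ.premise, a.eval id γ ∈ T.canonicalDB.map (Atom.map f)) →
      ∀ a ∈ σ.premise, a.eval Term.const (g ∘ γ) ∈ T.canonicalDB := by
    intro σ hσ γ hγ a ha
    rw [← Atom.map_eval (ι := id) (f := g)]
    · exact hback _ (hγ a ha)
    · intro c i hi
      refine hg c (Or.inr ?_)
      simp only [Set.mem_iUnion]
      exact ⟨σ, hσ, a, ha, i, hi⟩
  refine ⟨T.canonicalDB.map (Atom.map f), fun σ hσ => ?_, f ∘ ρ, fun a ha => ?_,
    fun x hx y hy hxy => ?_⟩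
  · have hσT := hM σ hσ
    have hp := hpull σ hσ
    cases σ with
    | tgd τ =>
      intro γ hγ
      obtain ⟨γ', h1, h2⟩ := hσT _ (hp γ hγ)
      refine ⟨f ∘ γ', fun x hx => ?_, fun a ha => ?_⟩
      · rw [Function.comp_apply, h1 x hx]
        exact hfg _
      · rw [← Atom.map_eval (ι := Term.const) (ι' := id) (f := f) fun c _ _ => hf c]
        exact Multiset.mem_map_of_mem _ (h2 a ha)
    | egd e =>
      intro γ hγ
      have hev : ∀ t : Term C, f (t.eval Term.const (g ∘ γ)) = t.eval id γ := by
        intro t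
        cases t with
        | var x => exact hfg _
        | const c => exact hf c
      rw [← hev, ← hev, hσT _ (hp γ hγ)]
    | setEnforcing r =>
      have hnd : (T.canonicalDB.map (Atom.map f)).Nodup := by
        refine Multiset.Nodup.map_on (fun a ha b hb hab => ?_) (Multiset.nodup_dedup _)
        rw [← Atom.map_map_eq_self (hgT a (hmem.mp ha)), hab,
          Atom.map_map_eq_self (hgT b (hmem.mp hb))]
      exact fun a _ => Multiset.nodup_iff_count_le_one.mp hnd a
  · rw [← Atom.map_eval (ι := Term.const) (ι' := id) (f := f) fun c _ _ => hf c]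
    exact Multiset.mem_map_of_mem _ (hmem.mpr (hc.subst_mem a ha))
  · obtain ⟨a, ha, i, hi⟩ := hc.exists_args_eq hx
    obtain ⟨b, hb, j, hj⟩ := hc.exists_args_eq hy
    rw [← hi, ← hj, ← hgT a ha i, ← hgT b hb j, hi, hj]
    exact congrArg g hxy

theorem Dependency.holds_iff_of_mem_iff {ι : C → Δ} {D D' : Database S Δ} {σ : Dependency S C}
    (hσ : ∀ r, σ ≠ .setEnforcing r) (h : ∀ a, a ∈ D ↔ a ∈ D') : σ.Holds ι D ↔ σ.Holds ι D' := by
  cases σ with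
  | tgd τ => simp only [Dependency.Holds, h]
  | egd e => simp only [Dependency.Holds, h]
  | setEnforcing r => exact absurd rfl (hσ r)

/-- If set-valuedness is not enforced for `r`, every model can be changed into one with the same
stored tuples in which every `r`-tuple is stored more than once. -/
theorem Models.double {Sig : Finset (Dependency S C)} {D : Database S C} (hD : Models id D Sig)
    {r : S.Rel} (hr : Dependency.setEnforcing r ∉ Sig) :
    ∃ D' : Database S C, Models id D' Sig ∧ (∀ a, a ∈ D' ↔ a ∈ D) ∧
      ∀ a ∈ D, a.rel = r → mult D' a ≠ 1 := by
  classical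
  have hmem : ∀ a, a ∈ D + D.filter (fun a => a.rel = r) ↔ a ∈ D := by
    intro a
    rw [Multiset.mem_add, Multiset.mem_filter]
    tauto
  refine ⟨D + D.filter fun a => a.rel = r, fun σ hσ => ?_, hmem, fun a ha har h1 => ?_⟩
  · by_cases hs : ∃ r', σ = .setEnforcing r'
    · obtain ⟨r', rfl⟩ := hs
      intro a ha
      have hne : ¬ a.rel = r := fun h => hr (h ▸ ha ▸ hσ)
      have := hD _ hσ a ha
      unfold mult at this ⊢
      rwa [Multiset.count_add, Multiset.count_filter, if_neg hne, add_zero]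
    · exact (Dependency.holds_iff_of_mem_iff (fun r' h => hs ⟨r', h⟩) hmem).mpr (hD σ hσ)
  · have := Multiset.count_pos.mpr ha
    unfold mult at h1
    rw [Multiset.count_add, Multiset.count_filter, if_pos har] at h1
    have h2 : D.count a + D.count a = 1 := by convert h1
    omega

theorem setEnforcing_notMem {Sig : Finset (Dependency S C)} {r : S.Rel}
    (hr : ¬ SetValuedOn Sig r) : Dependency.setEnforcing r ∉ Sig :=
  fun h => hr fun _ hD => hD _ h

theorem SetValuedOn.mult_eq_one {Sig : Finset (Dependency S C)} {r : S.Rel}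
    (hr : SetValuedOn Sig r) {D : Database S C} (hD : Models id D Sig) {a : Atom S C}
    (har : a.rel = r) (ha : a ∈ D) : mult D a = 1 :=
  le_antisymm (hr D hD a har) (mult_pos ha)

/-- If adding the subgoals `A` is sound, they are over relations that are set valued on all models:
otherwise such a relation can be doubled in a model on which `Q` has an answer. -/
theorem setValuedOn_of_bagEquiv [Nonempty C] {Sig : Finset (Dependency S C)} {Q Q' : CQ S C}
    {A : Multiset (Atom S (Term C))} (hhead : Q'.head = Q.head) (hbody : Q'.body = Q.body + A)
    (hext : ∀ D, Models id D Sig → ∀ γ, Satisfies γ Q.body D →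
      ∃ γ', Satisfies γ' Q'.body D ∧ Set.EqOn γ' γ Q.vars)
    (hmodel : ∃ D, Models id D Sig ∧ ∃ γ, Satisfies γ Q.body D) (hequiv : BagEquiv Sig Q Q') :
    ∀ a ∈ A, SetValuedOn Sig a.rel := by
  intro a ha
  by_contra hr
  obtain ⟨D, hD, γ, hγ⟩ := hmodel
  obtain ⟨D', hD', hmem, hmult⟩ := hD.double (setEnforcing_notMem hr)
  obtain ⟨γ', hγ', -⟩ := hext D' hD' γ fun b hb => (hmem _).mpr (hγ b hb)
  refine hmult _ ((hmem _).mp (hγ' a (by simpa [hbody] using Or.inr ha))) rfl ?_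
  exact (((bagAnswer_eq_iff_of_body_eq_add hhead hbody (hext D' hD')).mp
    (hequiv D' hD')) γ' hγ').1 a ha

/-! ### Soundness of chase steps -/

/-- Removal of duplicates is sound iff it concerns set-valued relations only. -/
theorem RemovesDuplicates.bagEquiv_iff [Nonempty C] {Sig : Finset (Dependency S C)} {Q Q' : CQ S C}
    (hd : RemovesDuplicates Q Q') (hmodel : ∃ D, Models id D Sig ∧ ∃ γ, Satisfies γ Q.body D) :
    BagEquiv Sig Q Q' ↔ ∀ a, mult Q'.body a < mult Q.body a → SetValuedOn Sig a.rel := by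
  classical
  obtain ⟨hhead, hle, hmem⟩ := hd
  have hbody : Q.body = Q'.body + (Q.body - Q'.body) := (add_tsub_cancel_of_le hle).symm
  have hext : ∀ D, Models id D Sig → ∀ γ, Satisfies γ Q'.body D →
      ∃ γ', Satisfies γ' Q.body D ∧ Set.EqOn γ' γ Q'.vars := fun _ _ γ hγ =>
    ⟨γ, fun a ha => hγ a (hmem a ha), fun _ _ => rfl⟩
  constructor
  · intro h a ha
    obtain ⟨D, hD, γ, hγ⟩ := hmodel
    refine setValuedOn_of_bagEquiv hhead.symm hbody hext
      ⟨D, hD, γ, fun b hb => hγ b (Multiset.mem_of_le hle hb)⟩ (fun D hD => (h D hD).symm) a ?_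
    exact Multiset.mem_sub.mpr ha
  · intro h D hD
    refine ((bagAnswer_eq_iff_of_body_eq_add hhead.symm hbody (hext D hD)).mpr
      fun γ hγ => ⟨fun a ha => ?_, fun γ' _ hγγ' => ?_⟩).symm
    · exact (h a (Multiset.mem_sub.mp ha)).mult_eq_one hD rfl
        (hγ a (Multiset.mem_of_le (Multiset.sub_le_self _ _) ha))
    · rintro x ⟨a, ha, i, hi⟩
      exact hγγ' ⟨a, hmem a ha, i, hi⟩

theorem Tgd.mem_vars_addAtoms {Q : CQ S C} {τ : Tgd S C} {h : ℕ → Term C} {z : ℕ → ℕ}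
    {A : Multiset (Atom S (Term C))} (hA : τ.headInstance h z ≤ A) {x : ℕ} (hx : x ∈ τ.exVars) :
    z x ∈ (Q.addAtoms A).vars := by
  classical
  obtain ⟨a, ha, i, hi⟩ := hx.1
  refine ⟨_, Multiset.mem_add.mpr (Or.inr (Multiset.mem_of_le hA (Multiset.mem_map_of_mem _ ha))),
    i, ?_⟩
  change (a.args i).eval Term.const _ = _
  rw [hi]
  exact if_pos hx

theorem Tgd.vars_headInstance {Q : CQ S C} {τ : Tgd S C} {h : ℕ → Term C} {z : ℕ → ℕ}
    (hh : IsHom h {a | a ∈ τ.body} Q.body) {y : ℕ}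
    (hy : y ∈ (Q.addAtoms (τ.headInstance h z)).vars) :
    y ∈ Q.vars ∨ ∃ x ∈ τ.exVars, z x = y := by
  classical
  obtain ⟨b, hb, i, hi⟩ := hy
  rcases Multiset.mem_add.mp hb with hb | hb
  · exact Or.inl ⟨b, hb, i, hi⟩
  · obtain ⟨a, ha, rfl⟩ := Multiset.mem_map.mp hb
    change (a.args i).eval Term.const _ = _ at hi
    cases hx : a.args i with
    | const c => simp [hx, Term.eval] at hi
    | var x =>
      rw [hx] at hi
      change (if x ∈ τ.exVars then Term.var (z x) else h x) = _ at hi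
      by_cases hex : x ∈ τ.exVars
      · rw [if_pos hex] at hi
        exact Or.inr ⟨x, hex, Term.var.inj hi⟩
      · rw [if_neg hex] at hi
        refine Or.inl (hh.mem_vars ?_ hi)
        by_contra hxb
        exact hex ⟨⟨a, ha, i, hx⟩, hxb⟩

/-- The values of the existential variables `Z̄` in an instance of the head named by `z`, and the
values `γ ∘ h` of the universally quantified ones. -/
noncomputable def Tgd.pullback (τ : Tgd S C) (h : ℕ → Term C) (z : ℕ → ℕ) (γ : ℕ → C) : ℕ → C :=
  open Classical in fun x => if x ∈ τ.exVars then γ (z x) else (h x).eval id γ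

theorem Tgd.pullback_of_mem {τ : Tgd S C} {h : ℕ → Term C} {z : ℕ → ℕ} {γ : ℕ → C} {x : ℕ}
    (hx : x ∈ τ.exVars) : τ.pullback h z γ x = γ (z x) := if_pos hx

/-- An instance of the head may be renamed: if `γ'` agrees with `γ` on `Q` and takes the values of
`γ` at the variables named by `z` at those named by `z'`, it satisfies the instance named by `z'`. -/
theorem Satisfies.rename {Q : CQ S C} {τ : Tgd S C} {h : ℕ → Term C} {z z' : ℕ → ℕ}
    (hh : IsHom h {a | a ∈ τ.body} Q.body) {γ γ' : ℕ → C} {D : Database S C}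
    (hγ : Satisfies γ (τ.headInstance h z) D) (heq : Set.EqOn γ' γ Q.vars)
    (hz : ∀ x ∈ τ.exVars, γ' (z' x) = γ (z x)) : Satisfies γ' (τ.headInstance h z') D := by
  have hb : ∀ x ∈ atomVars {a | a ∈ τ.body}, τ.pullback h z γ x = (h x).eval id γ := fun x hx =>
    if_neg fun hex => hex.2 hx
  refine (eval_headInstance hh heq (δ := τ.pullback h z γ)
    (fun x hx => (hz x hx).trans (Tgd.pullback_of_mem hx).symm) hb).mpr ?_
  exact (eval_headInstance hh (fun _ _ => rfl) (fun x hx => (Tgd.pullback_of_mem hx).symm) hb).mp hγ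

/-- For an assignment-fixing tgd, on every model the extension of an assignment to the existential
variables is unique. -/
theorem AssignmentFixing.eqOn {Sig : Finset (Dependency S C)} {Q : CQ S C} {τ : Tgd S C}
    {h : ℕ → Term C} {z : ℕ → ℕ} (hfix : AssignmentFixing Sig Q τ h)
    (hh : IsHom h {a | a ∈ τ.body} Q.body) {D : Database S C}
    (hD : Models id D Sig) {γ γ' : ℕ → C}
    (hγ : Satisfies γ (Q.addAtoms (τ.headInstance h z)).body D)
    (hγ' : Satisfies γ' (Q.addAtoms (τ.headInstance h z)).body D) (heq : Set.EqOn γ γ' Q.vars) :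
    Set.EqOn γ γ' (Q.addAtoms (τ.headInstance h z)).vars := by
  obtain ⟨w, w', ⟨hw, hw', hww'⟩, ⟨ρ, T, hT⟩, hρ⟩ := hfix
  obtain ⟨δ₁, h1, h2⟩ := exists_override hw γ fun x => γ (z x)
  obtain ⟨δ, h3, h4⟩ := exists_override hw' δ₁ fun x => γ' (z x)
  have hδw : ∀ x ∈ τ.exVars, δ (w x) = γ (z x) := fun x hx =>
    (h4 _ fun y hy => (hww' x hx y hy).symm).trans (h1 x hx)
  have hδγ : Set.EqOn δ γ Q.vars := fun y hy =>
    (h4 y fun x hx hxy => hw'.2 x hx (hxy ▸ hy)).trans (h2 y fun x hx hxy => hw.2 x hx (hxy ▸ hy))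
  have hQ : ∀ {γ}, Satisfies γ (Q.addAtoms (τ.headInstance h z)).body D →
      Satisfies γ Q.body D ∧ Satisfies γ (τ.headInstance h z) D := fun hγ =>
    ⟨fun a ha => hγ a (Multiset.mem_add.mpr (Or.inl ha)),
      fun a ha => hγ a (Multiset.mem_add.mpr (Or.inr ha))⟩
  have hδ : Satisfies δ (testQuery Q τ h w w').body D :=
    ((hQ hγ).1.congr hδγ).add (((hQ hγ).2.rename hh hδγ hδw).add
      ((hQ hγ').2.rename hh (hδγ.trans heq) h3))
  obtain ⟨ε, -, hε⟩ := hT.1.exists_satisfies hD hδ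
  intro y hy
  rcases Tgd.vars_headInstance hh hy with hy | ⟨x, hx, rfl⟩
  · exact heq hy
  · rw [← hδw x hx, ← h3 x hx, ← hε _ (Tgd.mem_vars_addAtoms (Multiset.le_add_right _ _) hx),
      ← hε _ (Tgd.mem_vars_addAtoms (Multiset.le_add_left _ _) hx), hρ ρ T hT x hx]

/-- If extensions of assignments are unique on every model, the tgd is assignment fixing: the model
obtained from the test query carries two extensions of one assignment. -/
theorem assignmentFixing_of_eqOn [Infinite C] {Sig : Finset (Dependency S C)} {Q : CQ S C}
    {τ : Tgd S C} {h : ℕ → Term C} {z : ℕ → ℕ} (htest : TestChaseExists Sig Q τ h)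
    (hh : IsHom h {a | a ∈ τ.body} Q.body) (hz : τ.FreshNames Q z)
    (huniq : ∀ D, Models id D Sig → ∀ γ γ' : ℕ → C,
      Satisfies γ (Q.addAtoms (τ.headInstance h z)).body D →
      Satisfies γ' (Q.addAtoms (τ.headInstance h z)).body D → Set.EqOn γ γ' Q.vars →
      Set.EqOn γ γ' (Q.addAtoms (τ.headInstance h z)).vars) :
    AssignmentFixing Sig Q τ h := by
  obtain ⟨w, w', hw, hres⟩ := htest
  refine ⟨w, w', hw, hres, fun ρ T hT x hx => ?_⟩
  obtain ⟨D, hD, γ, hγ, hinj⟩ := hT.exists_model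
  refine hinj _ (Tgd.mem_vars_addAtoms (Multiset.le_add_right _ _) hx) _
    (Tgd.mem_vars_addAtoms (Multiset.le_add_left _ _) hx) ?_
  have hγQ : Satisfies γ Q.body D := fun a ha => hγ a (Multiset.mem_add.mpr (Or.inl ha))
  have hγA : Satisfies γ (τ.headInstance h w + τ.headInstance h w') D := fun a ha =>
    hγ a (Multiset.mem_add.mpr (Or.inr ha))
  have key : ∀ v : ℕ → ℕ, Satisfies γ (τ.headInstance h v) D →
      ∃ δ, Satisfies δ (Q.addAtoms (τ.headInstance h z)).body D ∧ Set.EqOn δ γ Q.vars ∧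
        δ (z x) = γ (v x) := by
    intro v hv
    obtain ⟨δ, h1, h2⟩ := exists_override hz γ fun x => γ (v x)
    have heq : Set.EqOn δ γ Q.vars := fun y hy => h2 y fun x hx hxy => hz.2 x hx (hxy ▸ hy)
    exact ⟨δ, (hγQ.congr heq).add (hv.rename hh heq h1), heq, h1 x hx⟩
  obtain ⟨δ, h1, h2, h3⟩ := key w fun a ha => hγA a (Multiset.mem_add.mpr (Or.inl ha))
  obtain ⟨δ', h1', h2', h3'⟩ := key w' fun a ha => hγA a (Multiset.mem_add.mpr (Or.inr ha))
  rw [← h3, ← h3']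
  exact huniq D hD δ δ' h1 h1' (h2.trans h2'.symm) (Tgd.mem_vars_addAtoms le_rfl hx)

theorem Tgd.forall_headInstance_rel {τ : Tgd S C} {h : ℕ → Term C} {z : ℕ → ℕ}
    {P : S.Rel → Prop} : (∀ a ∈ τ.headInstance h z, P a.rel) ↔ ∀ a ∈ τ.head, P a.rel :=
  Multiset.forall_mem_map_iff

/-- A step with a tgd is sound iff the tgd is assignment fixing and the relations of the added
subgoals are set valued on all models. -/
theorem Tgd.bagEquiv_iff [Infinite C] {Sig : Finset (Dependency S C)} {Q : CQ S C}
    {τ : Tgd S C} {h : ℕ → Term C} {z : ℕ → ℕ} (hτ : Dependency.tgd τ ∈ Sig)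
    (hh : IsHom h {a | a ∈ τ.body} Q.body) (hz : τ.FreshNames Q z)
    (hmodel : ∃ D, Models id D Sig ∧ ∃ γ, Satisfies γ Q.body D)
    (htest : TestChaseExists Sig Q τ h) :
    BagEquiv Sig Q (Q.addAtoms (τ.headInstance h z)) ↔
      AssignmentFixing Sig Q τ h ∧ ∀ a ∈ τ.head, SetValuedOn Sig a.rel := by
  have hext : ∀ D, Models id D Sig → ∀ γ, Satisfies γ Q.body D →
      ∃ γ', Satisfies γ' (Q.addAtoms (τ.headInstance h z)).body D ∧ Set.EqOn γ' γ Q.vars :=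
    fun D hD γ hγ => τ.exists_extension hh hz (hD _ hτ) hγ
  have hiff := fun D hD => bagAnswer_eq_iff_of_body_eq_add
    (Q := Q) (Q' := Q.addAtoms (τ.headInstance h z)) rfl rfl
    (hext D hD)
  constructor
  · intro hequiv
    refine ⟨assignmentFixing_of_eqOn htest hh hz fun D hD γ γ' hγ hγ' heq => ?_, ?_⟩
    · exact ((hiff D hD).mp (hequiv D hD) γ hγ).2 γ' hγ' heq
    · exact Tgd.forall_headInstance_rel.mp
        (setValuedOn_of_bagEquiv (Q := Q) (Q' := Q.addAtoms (τ.headInstance h z)) rfl rfl hext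
          hmodel hequiv)
  · rintro ⟨hfix, hset⟩ D hD
    refine (hiff D hD).mpr fun γ hγ => ⟨fun a ha => ?_, fun γ' hγ' heq => ?_⟩
    · exact (Tgd.forall_headInstance_rel.mpr hset a ha).mult_eq_one hD rfl
        (hγ a (Multiset.mem_add.mpr (Or.inr ha)))
    · exact hfix.eqOn hh hD hγ hγ' heq

end BagChase

open BagChase
theorem theorem4p1 {S : Schema} {C : Type*} [Infinite C]
    (Sig : Finset (Dependency S C)) (hreg : RegularizedSet Sig)
    (Q : CQ S C) (hQ : HasSetChaseResult Sig Q)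
    (σ : Dependency S C) (hσ : σ ∈ Sig) (h : ℕ → Term C) (Q₁ Q' : CQ S C)
    (hstep : BagChaseStep σ h Q Q₁ Q')
    (htest : ∀ τ : Tgd S C, σ = .tgd τ → TestChaseExists Sig Q τ h) :
    BagEquiv Sig Q Q' ↔
      (∃ τ : Tgd S C, σ = .tgd τ ∧ AssignmentFixing Sig Q τ h ∧
          ∀ a ∈ τ.head, SetValuedOn Sig a.rel) ∨
      (σ.IsEgd ∧ ∀ a, mult Q'.body a < mult Q₁.body a → SetValuedOn Sig a.rel) := by
  obtain ⟨ρ, T, hT⟩ := hQ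
  obtain ⟨D, hD, γ, hγ, -⟩ := hT.exists_model
  cases hstep with
  | tgd hs =>
    cases hs with
    | tgd τ h z Q happ hz =>
      rw [Tgd.bagEquiv_iff hσ happ.1 hz ⟨D, hD, γ, hγ⟩ (htest _ rfl)]
      simp [Dependency.IsEgd]
  | egd hs hd =>
    cases hs with
    | egd e h x t Q hhom heq hne =>
      have hr : ∀ D, Models id D Sig → ∀ γ, Satisfies γ Q.body D →
          ∀ y ∈ Q.vars, (replaceVar x t y).eval id γ = γ y := fun D hD γ hγ y _ =>
        Egd.replaceVar_eval hhom heq (hD _ hσ) hγ y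
      have hsub : BagEquiv Sig Q Q' ↔ BagEquiv Sig (Q.subst (replaceVar x t)) Q' :=
        forall₂_congr fun D hD => by rw [bagAnswer_subst (hr D hD)]
      rw [hsub, hd.bagEquiv_iff ⟨D, hD, γ, hγ.subst (hr D hD γ hγ)⟩]
      simp [Dependency.IsEgd]
  | setEnforcing a ha hd =>
    rw [hd.bagEquiv_iff ⟨D, hD, γ, hγ⟩]
    simp [Dependency.IsEgd]
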